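/- **Model.** Let $c\ge 0$ be real and $S_c=\{d\in\mathbb Z^2:\|d\|_2\le c\}$. A *field* is a map $f:(\mathbb Z/k)^2\to\{0,1\}$; all $2^{k^2}$ fields are equally likely. For $h\in(\mathbb Z/k)^2$, the *pattern* of $f$ at $h$ is $(f(h+d))_{d\in S_c}\in\{0,1\}^{S_c}$ (circular boundary). Let $\mathcal X,\mathcal Y$ be finite sets, $\Psi:\{0,1\}^{S_c}\to\mathcal X$ any function and $P_{Y|X}$ a conditional p.m.f. A *sensor network* is a choice of locations $h_1,\dots,h_n\in(\mathbb Z/k)^2$; sensor $\ell$ has ideal output $x_\ell=\Psi(\text{pattern of }f\text{ at }h_\ell)$ and, independently given $f$, noisy output $y_\ell\sim P_{Y|X}(\cdot|x_\ell)$. A detector $g:\mathcal Y^n\to\{0,1\}^{(\mathbb Z/k)^2}$ is in error at distortion $D\in[0,1]$ if $\frac1{k^2}d_H(f,g(y))\ge D$. The expected error probability of a network with a detector is its error probability averaged over the equally likely fields $f$ and over the noise. At rate $R>0$, $n$ sensors observe a $k\times k$ field with $k=\lceil\sqrt{nR}\,\rceil$, so that $k^2/n\to R$. The rate $R$ is *achievable*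 if there are networks and detectors for $n=1,2,\dots$ at rate $R$ whose expected error probability tends to $0$ as $n\to\infty$. The *sensing capacity* $C(D)\in[0,\infty]$ is the largest value such that all rates $0<R<C(D)$ are achievable. **Types.** The joint type of two $k\times k$ fields $f_i,f_j$ is $\lambda=(\lambda_{(a)(b)})_{a,b\in\{0,1\}^{S_c}}$, where $\lambda_{(a)(b)}$ is the fraction of positions $h$ at which $f_i$ has pattern $a$ and $f_j$ has pattern $b$. Let $\mathcal P^2$ be the closure of the set of joint types of all pairs of $k\times k$ fields, $k\ge1$. For $\lambda\in\mathcal P^2$ let $\gamma_i,\gamma_j$ be its marginals in $a$ and in $b$, let $\lambda_{(u)(v)}$ be the total mass of the $(a,b)$ whose values at the central offset $0\in S_c$ are $u$ and $v$, and define $\gamma_{i(u)},\gamma_{j(u)}$ similarly. Put $$P^{\gamma_i}_{X_iY}(x,y)=\sum_{a:\Psi(a)=x}\gamma_{i,a}\,P_{Y|X}(y|x),\qquad Q^\lambda_{X_iY}(x,y)=\sum_{x'\in\mathcal X}\ \sum_{a,b:\Psi(a)=x,\Psi(b)=x'}\lambda_{(a)(b)}\,P_{Y|X}(y|x').$$ **Theorem.**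 For every $D\in[0,1]$, the minimum $$C_{LB}(D)=\min_{\substack{\lambda\in\mathcal P^2:\ \lambda_{(0)(1)}+\lambda_{(1)(0)}\ge D,\\ \gamma_{i(0)}=\gamma_{i(1)}=1/2}}\frac{D\big(P^{\gamma_i}_{X_iY}\,\|\,Q^{\lambda}_{X_iY}\big)}{H\big((\gamma_{j(0)},\gamma_{j(1)})\big)}\in[0,\infty]$$ is attained and $C(D)\ge C_{LB}(D)$. Here $D(\cdot\|\cdot)$ is the Kullback–Leibler distance and $H$ the entropy, both with base-2 logarithms, and a quotient with denominator $0$ is $\infty$ if its numerator is positive and $0$ if its numerator is $0$. Moreover, for every rate $0<R<C_{LB}(D)$ there are detectors, depending on the network, such that the expected error probability at rate $R$, averaged over networks whose $n$ sensor locations are chosen independently and uniformly at random, tends to $0$ as $n\to\infty$. -/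

import Mathlib

open Filter Topology
open scoped NNReal ENNReal

noncomputable section

namespace SensorField

/-- A binary target field on the `k × k` grid (`1` = target present, `0` = no target). -/
abbrev Field (k : ℕ) : Type := Fin k × Fin k → Fin 2

/-- The coordinate `x + t` modulo `k`. -/
def wrap {k : ℕ} (x : Fin k) (t : ℤ) : Fin k :=
  ⟨(((x : ℕ) + t) % (k : ℤ)).toNat, by
    have hk : (0 : ℤ) < k := by exact_mod_cast x.pos
    have h0 := Int.emod_nonneg (((x : ℕ) : ℤ) + t) hk.ne'
    have h1 := Int.emod_lt_of_pos (((x : ℕ) : ℤ) + t) hk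
    omega⟩

open scoped Classical in
/-- The offsets `d ∈ ℤ²` of Euclidean length at most `c`: the coverage of a sensor of range `c`,
relative to its location. The enclosing square only serves to make this a `Finset`; see
`mem_coverage`. -/
def coverage (c : ℝ≥0) : Finset (ℤ × ℤ) :=
  (Finset.Icc (-⌊(c : ℝ)⌋) ⌊(c : ℝ)⌋ ×ˢ Finset.Icc (-⌊(c : ℝ)⌋) ⌊(c : ℝ)⌋).filter
    fun d => √((d.1 : ℝ) ^ 2 + (d.2 : ℝ) ^ 2) ≤ c

theorem mem_coverage (c : ℝ≥0) (d : ℤ × ℤ) :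
    d ∈ coverage c ↔ √((d.1 : ℝ) ^ 2 + (d.2 : ℝ) ^ 2) ≤ c := by
  have key : ∀ z : ℤ, |(z : ℝ)| ≤ c → z ∈ Finset.Icc (-⌊(c : ℝ)⌋) ⌊(c : ℝ)⌋ := by
    intro z hz
    have h := abs_le.1 hz
    rw [Finset.mem_Icc]
    refine ⟨?_, Int.le_floor.2 h.2⟩
    have : -z ≤ ⌊(c : ℝ)⌋ := Int.le_floor.2 (by push_cast; linarith [h.1])
    linarith
  unfold coverage
  rw [Finset.mem_filter, Finset.mem_product]
  refine ⟨fun h => h.2, fun h => ⟨⟨key _ ?_, key _ ?_⟩, h⟩⟩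
  · refine le_trans ?_ h
    exact Real.abs_le_sqrt (by nlinarith [sq_nonneg (d.2 : ℝ)])
  · refine le_trans ?_ h
    exact Real.abs_le_sqrt (by nlinarith [sq_nonneg (d.1 : ℝ)])

/-- A bit pattern over the coverage of a sensor of range `c`, an element of `{0,1}^{|S_c|}`. -/
abbrev Pattern (c : ℝ≥0) : Type := coverage c → Fin 2

/-- The sensor's own location inside its coverage. -/
def center (c : ℝ≥0) : coverage c := ⟨(0, 0), by simp [mem_coverage]⟩

/-- The pattern which a sensor located at `h` sees in the field `f` (circular boundary). -/
def patternAt (c : ℝ≥0) {k : ℕ} (f : Field k) (h : Fin k × Fin k) : Pattern c :=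
  fun d => f (wrap h.1 d.1.1, wrap h.2 d.1.2)

/-! ### Sensor networks, error probability, sensing capacity -/

/-- A network of `n` sensors: the grid location of every sensor. -/
abbrev Network (k n : ℕ) : Type := Fin n → Fin k × Fin k

section Network

variable {𝒳 𝒴 : Type*} [Fintype 𝒴] {c : ℝ≥0}

/-- The law `P(y | f, s)` of the sensor outputs: sensor `ℓ` has ideal output `Ψ` of the pattern it
sees, observed through the noise `W = P_{Y|X}`, independently over the sensors. -/
def outputProb (Ψ : Pattern c → 𝒳) (W : 𝒳 → PMF 𝒴) {k n : ℕ} (s : Network k n) (f : Field k)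
    (y : Fin n → 𝒴) : ℝ :=
  ∏ l, (W (Ψ (patternAt c f (s l))) (y l)).toReal

/-- `f'` is in the tolerable distortion region of `f`: normalized Hamming distance less
than `D`. -/
def Tolerable (D : ℝ) {k : ℕ} (f f' : Field k) : Prop :=
  (hammingDist f f' : ℝ) / (k : ℝ) ^ 2 < D

open scoped Classical in
/-- The probability that the detector `g` decides for a field outside the tolerable distortion
region, given that the field `f` occurred. -/
def errorGiven (Ψ : Pattern c → 𝒳) (W : 𝒳 → PMF 𝒴) (D : ℝ) {k n : ℕ} (s : Network k n)
    (g : (Fin n → 𝒴) → Field k) (f : Field k) : ℝ :=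
  ∑ y : Fin n → 𝒴, if Tolerable D f (g y) then 0 else outputProb Ψ W s f y

/-- The expected error probability of the network `s` with detector `g`, all fields being equally
likely. -/
def expectedError (Ψ : Pattern c → 𝒳) (W : 𝒳 → PMF 𝒴) (D : ℝ) {k n : ℕ} (s : Network k n)
    (g : (Fin n → 𝒴) → Field k) : ℝ :=
  (∑ f : Field k, errorGiven Ψ W D s g f) / (Fintype.card (Field k) : ℝ)

/-- The side of the smallest square grid with at least `n * R` positions, so that
`k² / n → R`. -/
def gridSide (R : ℝ) (n : ℕ) : ℕ := ⌈√((n : ℝ) * R)⌉₊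

/-- There are networks of `n` sensors at rate `R` whose expected error probability tends to `0`
as `n → ∞`. -/
def Achievable (Ψ : Pattern c → 𝒳) (W : 𝒳 → PMF 𝒴) (D R : ℝ) : Prop :=
  ∃ (s : ∀ n, Network (gridSide R n) n) (g : ∀ n, (Fin n → 𝒴) → Field (gridSide R n)),
    Tendsto (fun n => expectedError Ψ W D (s n) (g n)) atTop (𝓝 0)

/-- The sensing capacity `C(D)`: the largest rate (possibly `∞`) below which every positive rate is
achievable. -/
def sensingCapacity (Ψ : Pattern c → 𝒳) (W : 𝒳 → PMF 𝒴) (D : ℝ) : ℝ≥0∞ :=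
  sSup {C : ℝ≥0∞ | ∀ R : ℝ, 0 < R → ENNReal.ofReal R < C → Achievable Ψ W D R}

/-- At rate `R`, the expected error probability averaged over the random ensemble, in which every
sensor chooses its location independently and uniformly, tends to `0` as `n → ∞`
(the detector knows the network). -/
def EnsembleAchievable (Ψ : Pattern c → 𝒳) (W : 𝒳 → PMF 𝒴) (D R : ℝ) : Prop :=
  ∃ g : ∀ n, Network (gridSide R n) n → (Fin n → 𝒴) → Field (gridSide R n),
    Tendsto (fun n => (∑ s : Network (gridSide R n) n, expectedError Ψ W D s (g n s)) /
      (Fintype.card (Network (gridSide R n) n) : ℝ)) atTop (𝓝 0)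

end Network

/-! ### Two-dimensional types -/

/-- The two-dimensional joint type of the fields `f`, `f'`: the fraction of grid positions at which
`f` shows the pattern `p.1` while `f'` shows `p.2`. -/
def jointType (c : ℝ≥0) {k : ℕ} (f f' : Field k) (p : Pattern c × Pattern c) : ℝ :=
  (((Finset.univ.filter fun h : Fin k × Fin k =>
      patternAt c f h = p.1 ∧ patternAt c f' h = p.2).card : ℕ) : ℝ) / (k : ℝ) ^ 2

/-- The joint types `P_k²` of `k × k` fields. -/
def jointTypesOfSide (c : ℝ≥0) (k : ℕ) : Set (Pattern c × Pattern c → ℝ) :=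
  {q | ∃ f f' : Field k, q = jointType c f f'}

/-- The joint types `P²` of unrestricted field size: all limits of joint types of finite fields. -/
def jointTypes (c : ℝ≥0) : Set (Pattern c × Pattern c → ℝ) :=
  closure (⋃ k ∈ {k : ℕ | 1 ≤ k}, jointTypesOfSide c k)

/-- The type `γ_i` of the first field. -/
def fstType {c : ℝ≥0} (q : Pattern c × Pattern c → ℝ) (a : Pattern c) : ℝ := ∑ b, q (a, b)

/-- The type `γ_j` of the second field. -/
def sndType {c : ℝ≥0} (q : Pattern c × Pattern c → ℝ) (b : Pattern c) : ℝ := ∑ a, q (a, b)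

/-- `γ_(u)`: the fraction of positions with value `u`. -/
def bitFreq {c : ℝ≥0} (γ : Pattern c → ℝ) (u : Fin 2) : ℝ :=
  ∑ a : Pattern c, if a (center c) = u then γ a else 0

/-- `λ_(u)(v)`: the fraction of positions where the first field has value `u` and the second has
value `v`. -/
def jointBitFreq {c : ℝ≥0} (q : Pattern c × Pattern c → ℝ) (u v : Fin 2) : ℝ :=
  ∑ a : Pattern c, ∑ b : Pattern c, if a (center c) = u ∧ b (center c) = v then q (a, b) else 0

/-- Joint types with `λ_(0)(1) + λ_(1)(0) ≥ D` and `γ_i(0) = γ_i(1) = 1/2`. -/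
def feasibleTypes (c : ℝ≥0) (D : ℝ) : Set (Pattern c × Pattern c → ℝ) :=
  {q | q ∈ jointTypes c ∧ D ≤ jointBitFreq q 0 1 + jointBitFreq q 1 0 ∧
    bitFreq (fstType q) 0 = 1 / 2 ∧ bitFreq (fstType q) 1 = 1 / 2}

/-! ### Information quantities (base 2) and the bound -/

/-- Entropy in bits. -/
def entropyBits {ι : Type*} [Fintype ι] (p : ι → ℝ) : ℝ :=
  ∑ x, -(p x * Real.logb 2 (p x))

open scoped Classical in
/-- Kullback-Leibler distance in bits of two probability mass functions on a finite set; it is `∞`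
unless `p` is absolutely continuous with respect to `q`. -/
def klBits {ι : Type*} [Fintype ι] (p q : ι → ℝ) : ℝ≥0∞ :=
  if ∀ x, q x = 0 → p x = 0 then ENNReal.ofReal (∑ x, p x * Real.logb 2 (p x / q x)) else ∞

section Bound

variable {𝒳 𝒴 : Type*} [Fintype 𝒳] [DecidableEq 𝒳] [Fintype 𝒴] {c : ℝ≥0}

/-- `P^γ(x)`: the law of the ideal output of a uniformly located sensor in a field of type `γ`. -/
def idealDist (Ψ : Pattern c → 𝒳) (γ : Pattern c → ℝ) (x : 𝒳) : ℝ :=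
  ∑ a, if Ψ a = x then γ a else 0

/-- `P^λ(x, x')`: the joint law of the ideal outputs of a uniformly located sensor in two fields of
joint type `λ`. -/
def idealJointDist (Ψ : Pattern c → 𝒳) (q : Pattern c × Pattern c → ℝ) (x x' : 𝒳) : ℝ :=
  ∑ a, ∑ b, if Ψ a = x ∧ Ψ b = x' then q (a, b) else 0

/-- `P^γ_{X_i Y}(x, y) = P^γ(x) P(y|x)`. -/
def distP (Ψ : Pattern c → 𝒳) (W : 𝒳 → PMF 𝒴) (γ : Pattern c → ℝ) (z : 𝒳 × 𝒴) : ℝ :=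
  idealDist Ψ γ z.1 * (W z.1 z.2).toReal

/-- `Q^λ_{X_i Y}(x, y) = ∑_{x'} P^λ(x, x') P(y|x')`. -/
def distQ (Ψ : Pattern c → 𝒳) (W : 𝒳 → PMF 𝒴) (q : Pattern c × Pattern c → ℝ) (z : 𝒳 × 𝒴) : ℝ :=
  ∑ x', idealJointDist Ψ q z.1 x' * (W x' z.2).toReal

/-- `D(P^{γ_i}_{X_i Y} ‖ Q^λ_{X_i Y}) / H((γ_j(0), γ_j(1)))`, in `[0, ∞]`. When the entropy is zero
this is `∞` for a nonzero numerator and `0` for a zero numerator. -/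
def boundRatio (Ψ : Pattern c → 𝒳) (W : 𝒳 → PMF 𝒴) (q : Pattern c × Pattern c → ℝ) : ℝ≥0∞ :=
  klBits (distP Ψ W (fstType q)) (distQ Ψ W q) / ENNReal.ofReal (entropyBits (bitFreq (sndType q)))

end Bound

end SensorField

end

/-! The argument is random coding with maximum likelihood detection. Fix the true field and sort the
intolerable rivals by their joint type `q` with it. Under a uniformly random sensor position, the
pair (ideal output of the truth, noisy output) has law P if the truth emits the noisy output and law
Q if a rival of type `q` does. For a prescribed sequence of such pairs, the error probability is at
most a product of P's, and by the union bound at most the number of rivals times a product of Q's.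
Interpolating with weights `1 - ρ` and `ρ` and summing gives `|J| ^ ρ * chernoffSum ρ P Q ^ n`
(`sum_likelihood_exceeded_le`). All rivals in `J` share the bit frequencies of the second marginal,
so `|J|` is at most 2 to the power `k ^ 2` times their entropy H (`card_le_exp_entropyBits`), and
there are only polynomially many types.

A type is therefore harmless at rate `R` once `exp (ρ R H log 2) * chernoffSum ρ P Q < 1` for some
`ρ`. Since `(1 - chernoffSum ρ P Q) / ρ` has supremum `log 2` times the Kullback-Leibler distance,
such a `ρ` exists whenever `R` is below the ratio of that distance to H
(`ofReal_lt_boundRatio_iff`).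

The same supremum of continuous functions shows that the ratio is lower semicontinuous, infinite
values included, so its minimum over the compact feasible set is attained. Compactness also extends
the strict inequality from exactly balanced to nearly balanced true fields with a uniform margin
(`exists_uniform_exponent`); the remaining fields are exponentially rare (`card_unbalanced_le`). -/

namespace SensorField

/-! ### Chernoff sums and the Kullback-Leibler distance -/

/-- The Chernoff sum `∑ p^(1-ρ) q^ρ`. -/
noncomputable def chernoffSum {ι : Type*} [Fintype ι] (ρ : ℝ) (p q : ι → ℝ) : ℝ :=
  ∑ x, p x ^ (1 - ρ) * q x ^ ρ

/-- For `p > 0` the product is `p * exp (-ρ log (p / q))`, and `exp x ≥ 1 + x`. -/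
theorem sub_rpow_mul_rpow_le {p q ρ : ℝ} (hp : 0 ≤ p) (hq : 0 ≤ q) (hρ : ρ ∈ Set.Ioo (0 : ℝ) 1)
    (hpq : q = 0 → p = 0) : p - p ^ (1 - ρ) * q ^ ρ ≤ ρ * (p * Real.log (p / q)) := by
  rcases hp.eq_or_lt with rfl | hp
  · rw [Real.zero_rpow (by linarith [hρ.2])]; simp
  have hq : 0 < q := hq.lt_of_ne fun h => hp.ne' (hpq h.symm)
  have h1 : p ^ (1 - ρ) * q ^ ρ = p * Real.exp (-(ρ * Real.log (p / q))) := by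
    rw [Real.rpow_sub hp, Real.rpow_one, Real.rpow_def_of_pos hp, Real.rpow_def_of_pos hq,
      div_mul_eq_mul_div, mul_div_assoc, ← Real.exp_sub, Real.log_div hp.ne' hq.ne']
    congr 2; ring
  rw [h1]
  nlinarith [Real.add_one_le_exp (-(ρ * Real.log (p / q)))]

/-- For `p > 0` this is the derivative at `ρ = 0`, where the difference vanishes. -/
theorem tendsto_sub_rpow_mul_rpow_div {p q : ℝ} (hp : 0 ≤ p) (hq : 0 ≤ q)
    (hpq : q = 0 → p = 0) :
    Tendsto (fun ρ : ℝ => (p - p ^ (1 - ρ) * q ^ ρ) / ρ) (𝓝[>] 0)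
      (𝓝 (p * Real.log (p / q))) := by
  rcases hp.eq_or_lt with rfl | hp
  · simp only [zero_mul]
    refine tendsto_const_nhds.congr' ?_
    have : ∀ᶠ ρ : ℝ in 𝓝[>] 0, ρ < 1 := nhdsWithin_le_nhds (eventually_lt_nhds one_pos)
    filter_upwards [this] with ρ hρ
    rw [Real.zero_rpow (by linarith)]; simp
  have hq : 0 < q := hq.lt_of_ne fun h => hp.ne' (hpq h.symm)
  have hd : HasDerivAt (fun ρ : ℝ => p - p ^ (1 - ρ) * q ^ ρ) (p * Real.log (p / q)) 0 := by
    have h1 := ((hasDerivAt_id' (0 : ℝ)).const_sub 1).const_rpow hp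
    have h2 := (hasDerivAt_id' (0 : ℝ)).const_rpow hq
    refine ((h1.mul h2).const_sub p).congr_deriv ?_
    rw [Real.log_div hp.ne' hq.ne', sub_zero, Real.rpow_one, Real.rpow_zero]
    ring
  have h := hd.tendsto_slope_zero_right
  refine h.congr fun ρ => ?_
  simp [div_eq_inv_mul]

/-- Since `0 ^ ρ = 0` for `ρ > 0`, the mass of `p` off the support of `q` is lost in the limit. This
handles infinite Kullback-Leibler distance. -/
theorem tendsto_rpow_mul_rpow {p q : ℝ} (hp : 0 ≤ p) (hq : 0 ≤ q) :
    Tendsto (fun ρ : ℝ => p ^ (1 - ρ) * q ^ ρ) (𝓝[>] 0) (𝓝 (if q = 0 then 0 else p)) := by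
  split_ifs with h
  · subst h
    refine tendsto_const_nhds.congr' ?_
    filter_upwards [self_mem_nhdsWithin] with ρ hρ
    rw [Real.zero_rpow (ne_of_gt hρ), mul_zero]
  rcases hp.eq_or_lt with rfl | hp
  · refine tendsto_const_nhds.congr' ?_
    have : ∀ᶠ ρ : ℝ in 𝓝[>] 0, ρ < 1 := nhdsWithin_le_nhds (eventually_lt_nhds one_pos)
    filter_upwards [this] with ρ hρ
    rw [Real.zero_rpow (by linarith)]; simp
  have hq : 0 < q := hq.lt_of_ne (Ne.symm h)
  have hc : ContinuousAt (fun ρ : ℝ => p ^ (1 - ρ) * q ^ ρ) 0 :=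
    ((Real.continuousAt_const_rpow hp.ne').comp (f := fun ρ : ℝ => 1 - ρ) (by fun_prop)).mul
      (Real.continuousAt_const_rpow hq.ne')
  have := hc.tendsto.mono_left (nhdsWithin_le_nhds (s := Set.Ioi 0))
  simpa using this

/-- The Kullback-Leibler distance is the supremum over `ρ` of `(1 - chernoffSum ρ p q) / ρ`. -/
theorem ofReal_lt_klBits_iff {ι : Type*} [Fintype ι] {p q : ι → ℝ} (hp : ∀ x, 0 ≤ p x)
    (hq : ∀ x, 0 ≤ q x) (hsum : ∑ x, p x = 1) {r : ℝ} (hr : 0 ≤ r) :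
    ENNReal.ofReal r < klBits p q ↔
      ∃ ρ ∈ Set.Ioo (0 : ℝ) 1, ρ * (r * Real.log 2) < 1 - chernoffSum ρ p q := by
  have hl : 0 < Real.log 2 := Real.log_pos one_lt_two
  have hIoo : ∀ᶠ ρ : ℝ in 𝓝[>] 0, ρ ∈ Set.Ioo (0 : ℝ) 1 := Ioo_mem_nhdsGT one_pos
  have hF : ∀ ρ, 1 - chernoffSum ρ p q = ∑ x, (p x - p x ^ (1 - ρ) * q x ^ ρ) := by
    intro ρ; rw [Finset.sum_sub_distrib, hsum, chernoffSum]
  unfold klBits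
  split_ifs with hac
  · have hS : ∑ x, p x * Real.logb 2 (p x / q x) =
        (∑ x, p x * Real.log (p x / q x)) / Real.log 2 := by
      rw [Finset.sum_div]; exact Finset.sum_congr rfl fun x _ => by rw [Real.logb]; ring
    rw [hS]
    constructor
    · intro h
      have h := (ENNReal.ofReal_lt_ofReal_iff'.1 h).1
      rw [lt_div_iff₀ hl] at h
      have ht := tendsto_finsetSum Finset.univ fun x _ =>
        tendsto_sub_rpow_mul_rpow_div (hp x) (hq x) (hac x)
      obtain ⟨ρ, hρ, hlt⟩ := (hIoo.and (ht.eventually_const_lt h)).exists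
      refine ⟨ρ, hρ, ?_⟩
      rw [← Finset.sum_div, ← hF, lt_div_iff₀ hρ.1] at hlt
      linarith
    · rintro ⟨ρ, hρ, h⟩
      have h2 : ∑ x, (p x - p x ^ (1 - ρ) * q x ^ ρ) ≤
          ∑ x, ρ * (p x * Real.log (p x / q x)) :=
        Finset.sum_le_sum fun x _ => sub_rpow_mul_rpow_le (hp x) (hq x) hρ (hac x)
      rw [← hF, ← Finset.mul_sum] at h2
      have h3 := lt_of_mul_lt_mul_left (h.trans_le h2) hρ.1.le
      rw [← lt_div_iff₀ hl] at h3
      exact ENNReal.ofReal_lt_ofReal_iff'.2 ⟨h3, hr.trans_lt h3⟩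
  -- Without absolute continuity the Chernoff sum tends to the `p`-mass of the support of `q`, which
  -- is below 1, while `ρ * (r * log 2)` tends to 0; so every `r` is beaten by a small `ρ`.
  · refine ⟨fun _ => ?_, fun _ => ENNReal.ofReal_lt_top⟩
    push Not at hac
    obtain ⟨x₀, hx₀, hpx₀⟩ := hac
    have ht := tendsto_finsetSum Finset.univ fun x _ => tendsto_rpow_mul_rpow (hp x) (hq x)
    have hlim : ∑ x, (if q x = 0 then 0 else p x) < 1 := by
      rw [← hsum]
      refine Finset.sum_lt_sum (fun x _ => ?_) ⟨x₀, Finset.mem_univ _, ?_⟩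
      · split_ifs <;> simp [hp x]
      · simpa [hx₀] using (hp x₀).lt_of_ne (Ne.symm hpx₀)
    have ht2 : Tendsto (fun ρ : ℝ => ρ * (r * Real.log 2) +
        ∑ x, p x ^ (1 - ρ) * q x ^ ρ) (𝓝[>] 0) (𝓝 (0 * (r * Real.log 2) +
          ∑ x, (if q x = 0 then 0 else p x))) := by
      refine Tendsto.add (Tendsto.mul_const _ ?_) ht
      exact tendsto_nhdsWithin_of_tendsto_nhds tendsto_id
    rw [zero_mul, zero_add] at ht2
    obtain ⟨ρ, hρ, hlt⟩ := (hIoo.and (ht2.eventually_lt_const hlim)).exists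
    exact ⟨ρ, hρ, by rw [chernoffSum]; linarith⟩

/-- When the denominator vanishes, both sides reduce to `0 < N`; this needs `a` finite. -/
theorem ofReal_mul_lt_iff_lt_div {a N : ℝ≥0∞} {H : ℝ} (ha : a ≠ ∞) :
    a < N / ENNReal.ofReal H ↔ a * ENNReal.ofReal H < N := by
  rcases eq_or_ne (ENNReal.ofReal H) 0 with h | h
  · rw [h, mul_zero]
    rcases eq_or_ne N 0 with rfl | hN
    · simp
    · rw [ENNReal.div_zero hN]; simp [pos_iff_ne_zero, hN, lt_top_iff_ne_top, ha]
  · exact ENNReal.lt_div_iff_mul_lt (Or.inl h) (Or.inl ENNReal.ofReal_ne_top)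

theorem pmf_sum_toReal {α : Type*} [Fintype α] (p : PMF α) : ∑ y, (p y).toReal = 1 := by
  rw [← ENNReal.toReal_sum fun y _ => p.apply_ne_top y, ← tsum_fintype (L := .unconditional α), PMF.tsum_coe]
  rfl

/-! ### Joint types: averages over positions, compactness, continuity -/

section Types

variable {c : ℝ≥0}

theorem jointType_nonneg {k : ℕ} (f f' : Field k) (p : Pattern c × Pattern c) :
    0 ≤ jointType c f f' p := by unfold jointType; positivity

/-- Averages over the joint type are averages over the positions. -/
theorem sum_jointType_mul {k : ℕ} (f f' : Field k) (φ : Pattern c × Pattern c → ℝ) :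
    ∑ p, jointType c f f' p * φ p =
      (∑ h, φ (patternAt c f h, patternAt c f' h)) / (k : ℝ) ^ 2 := by
  classical
  rw [← Finset.sum_fiberwise Finset.univ
    (fun h => (patternAt c f h, patternAt c f' h)), Finset.sum_div]
  refine Finset.sum_congr rfl fun p _ => ?_
  rw [Finset.sum_congr rfl (g := fun _ => φ p) fun h hh => by rw [(Finset.mem_filter.1 hh).2],
    Finset.sum_const, nsmul_eq_mul, jointType]
  simp only [Prod.ext_iff]
  ring

theorem sum_jointType {k : ℕ} (hk : 1 ≤ k) (f f' : Field k) : ∑ p, jointType c f f' p = 1 := by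
  have h := sum_jointType_mul (c := c) f f' fun _ => 1
  simp only [mul_one] at h
  rw [h]
  have : (k : ℝ) ≠ 0 := by positivity
  simp [Fintype.card_prod]
  field_simp

theorem jointTypes_subset_stdSimplex : jointTypes c ⊆ stdSimplex ℝ (Pattern c × Pattern c) := by
  refine closure_minimal ?_ (isClosed_stdSimplex ℝ _)
  intro q hq
  simp only [Set.mem_iUnion] at hq
  obtain ⟨k, hk, f, f', rfl⟩ := hq
  exact ⟨jointType_nonneg f f', sum_jointType hk f f'⟩

theorem isCompact_jointTypes : IsCompact (jointTypes c) :=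
  (isCompact_stdSimplex ℝ _).of_isClosed_subset isClosed_closure jointTypes_subset_stdSimplex

theorem jointType_mem_jointTypes {k : ℕ} (hk : 1 ≤ k) (f f' : Field k) :
    jointType c f f' ∈ jointTypes c :=
  subset_closure (Set.mem_biUnion (show k ∈ {k : ℕ | 1 ≤ k} from hk) ⟨f, f', rfl⟩)

theorem continuous_bitFreq_fstType (u : Fin 2) :
    Continuous fun q : Pattern c × Pattern c → ℝ => bitFreq (fstType q) u := by
  unfold bitFreq fstType
  refine continuous_finsetSum _ fun a _ => ?_
  split_ifs <;> fun_prop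

theorem continuous_bitFreq_sndType (u : Fin 2) :
    Continuous fun q : Pattern c × Pattern c → ℝ => bitFreq (sndType q) u := by
  unfold bitFreq sndType
  refine continuous_finsetSum _ fun a _ => ?_
  split_ifs <;> fun_prop

theorem continuous_jointBitFreq (u v : Fin 2) :
    Continuous fun q : Pattern c × Pattern c → ℝ => jointBitFreq q u v := by
  unfold jointBitFreq
  refine continuous_finsetSum _ fun a _ => continuous_finsetSum _ fun b _ => ?_
  split_ifs <;> fun_prop

theorem continuous_entropyBits_sndType :
    Continuous fun q : Pattern c × Pattern c → ℝ => entropyBits (bitFreq (sndType q)) := by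
  unfold entropyBits
  refine continuous_finsetSum _ fun u _ => ?_
  simp only [Real.logb, ← mul_div_assoc]
  exact ((Real.continuous_mul_log.comp (continuous_bitFreq_sndType u)).div_const _).neg

theorem sum_bitFreq (γ : Pattern c → ℝ) : ∑ u, bitFreq γ u = ∑ a, γ a := by
  unfold bitFreq
  rw [Finset.sum_comm]
  exact Finset.sum_congr rfl fun a _ => by simp

theorem bitFreq_nonneg {γ : Pattern c → ℝ} (hγ : ∀ a, 0 ≤ γ a) (u : Fin 2) : 0 ≤ bitFreq γ u :=
  Finset.sum_nonneg fun a _ => by split_ifs <;> simp [hγ a]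

theorem sndType_nonneg {q : Pattern c × Pattern c → ℝ} (hq : ∀ p, 0 ≤ q p) (a : Pattern c) :
    0 ≤ sndType q a := Finset.sum_nonneg fun _ _ => hq _

theorem sum_fstType (q : Pattern c × Pattern c → ℝ) : ∑ a, fstType q a = ∑ p, q p :=
  (Fintype.sum_prod_type _).symm

theorem sum_sndType (q : Pattern c × Pattern c → ℝ) : ∑ a, sndType q a = ∑ p, q p :=
  (Fintype.sum_prod_type_right _).symm

theorem entropyBits_nonneg {ι : Type*} [Fintype ι] {p : ι → ℝ} (hp : ∀ x, 0 ≤ p x)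
    (hsum : ∑ x, p x = 1) : 0 ≤ entropyBits p := by
  refine Finset.sum_nonneg fun x _ => ?_
  have h1 : p x ≤ 1 := hsum ▸ Finset.single_le_sum (fun y _ => hp y) (Finset.mem_univ x)
  have := mul_nonpos_of_nonneg_of_nonpos (hp x) (Real.logb_nonpos one_lt_two (hp x) h1)
  linarith

end Types

/-! ### Marginals and output laws as linear functionals of the joint type -/

theorem bitFreq_fstType {c : ℝ≥0} (q : Pattern c × Pattern c → ℝ) (u : Fin 2) :
    bitFreq (fstType q) u = ∑ p, q p * if p.1 (center c) = u then 1 else 0 := by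
  unfold bitFreq fstType
  rw [Fintype.sum_prod_type]
  exact Finset.sum_congr rfl fun a _ => by split_ifs <;> simp

theorem bitFreq_sndType {c : ℝ≥0} (q : Pattern c × Pattern c → ℝ) (u : Fin 2) :
    bitFreq (sndType q) u = ∑ p, q p * if p.2 (center c) = u then 1 else 0 := by
  unfold bitFreq sndType
  rw [Fintype.sum_prod_type_right]
  exact Finset.sum_congr rfl fun a _ => by split_ifs <;> simp

theorem jointBitFreq_eq {c : ℝ≥0} (q : Pattern c × Pattern c → ℝ) (u v : Fin 2) :
    jointBitFreq q u v =
      ∑ p, q p * if p.1 (center c) = u ∧ p.2 (center c) = v then 1 else 0 := by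
  unfold jointBitFreq
  rw [Fintype.sum_prod_type]
  exact Finset.sum_congr rfl fun a _ => Finset.sum_congr rfl fun b _ => by split_ifs <;> simp

theorem distP_fstType {𝒳 𝒴 : Type*} [DecidableEq 𝒳] {c : ℝ≥0} (Ψ : Pattern c → 𝒳)
    (W : 𝒳 → PMF 𝒴) (q : Pattern c × Pattern c → ℝ) (z : 𝒳 × 𝒴) :
    distP Ψ W (fstType q) z =
      ∑ p, q p * if Ψ p.1 = z.1 then (W z.1 z.2).toReal else 0 := by
  unfold distP idealDist fstType
  rw [Fintype.sum_prod_type, Finset.sum_mul]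
  exact Finset.sum_congr rfl fun a _ => by split_ifs <;> simp [Finset.sum_mul]

theorem distQ_eq {𝒳 𝒴 : Type*} [Fintype 𝒳] [DecidableEq 𝒳] {c : ℝ≥0} (Ψ : Pattern c → 𝒳)
    (W : 𝒳 → PMF 𝒴) (q : Pattern c × Pattern c → ℝ) (z : 𝒳 × 𝒴) :
    distQ Ψ W q z = ∑ p, q p * if Ψ p.1 = z.1 then (W (Ψ p.2) z.2).toReal else 0 := by
  unfold distQ idealJointDist
  rw [Fintype.sum_prod_type]
  simp only [Finset.sum_mul]
  rw [Finset.sum_comm]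
  refine Finset.sum_congr rfl fun a _ => ?_
  rw [Finset.sum_comm]
  refine Finset.sum_congr rfl fun b _ => ?_
  by_cases h : Ψ a = z.1 <;> simp [h]

theorem sum_distP {𝒳 𝒴 : Type*} [Fintype 𝒳] [DecidableEq 𝒳] [Fintype 𝒴] {c : ℝ≥0}
    (Ψ : Pattern c → 𝒳) (W : 𝒳 → PMF 𝒴) (q : Pattern c × Pattern c → ℝ) :
    ∑ z, distP Ψ W (fstType q) z = ∑ p, q p := by
  simp only [distP_fstType]
  rw [Finset.sum_comm]
  refine Finset.sum_congr rfl fun p _ => ?_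
  rw [← Finset.mul_sum, Fintype.sum_prod_type, Finset.sum_eq_single (Ψ p.1)]
  · simp [pmf_sum_toReal]
  · intro x _ hx
    simp [hx.symm]
  · simp

theorem distP_nonneg {𝒳 𝒴 : Type*} [DecidableEq 𝒳] {c : ℝ≥0} (Ψ : Pattern c → 𝒳)
    (W : 𝒳 → PMF 𝒴) {q : Pattern c × Pattern c → ℝ} (hq : ∀ p, 0 ≤ q p) (z : 𝒳 × 𝒴) :
    0 ≤ distP Ψ W (fstType q) z := by
  rw [distP_fstType]
  exact Finset.sum_nonneg fun p _ => mul_nonneg (hq p) (by split_ifs <;> simp)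

theorem distQ_nonneg {𝒳 𝒴 : Type*} [Fintype 𝒳] [DecidableEq 𝒳] {c : ℝ≥0} (Ψ : Pattern c → 𝒳)
    (W : 𝒳 → PMF 𝒴) {q : Pattern c × Pattern c → ℝ} (hq : ∀ p, 0 ≤ q p) (z : 𝒳 × 𝒴) :
    0 ≤ distQ Ψ W q z := by
  rw [distQ_eq]
  exact Finset.sum_nonneg fun p _ => mul_nonneg (hq p) (by split_ifs <;> simp)

/-! ### Lower semicontinuity of the ratio -/

/-- Both exponents are positive, so continuity persists where masses vanish, which is where the
Kullback-Leibler distance itself fails to be continuous. -/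
theorem continuous_chernoffSum {𝒳 𝒴 : Type*} [Fintype 𝒳] [DecidableEq 𝒳] [Fintype 𝒴] {c : ℝ≥0}
    (Ψ : Pattern c → 𝒳) (W : 𝒳 → PMF 𝒴) {ρ : ℝ} (hρ : ρ ∈ Set.Ioo (0 : ℝ) 1) :
    Continuous fun q : Pattern c × Pattern c → ℝ =>
      chernoffSum ρ (distP Ψ W (fstType q)) (distQ Ψ W q) := by
  unfold chernoffSum
  simp only [distP_fstType, distQ_eq]
  refine continuous_finsetSum _ fun z _ => Continuous.mul ?_ ?_
  · exact Continuous.rpow_const (by fun_prop) fun _ => Or.inr (by linarith [hρ.2])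
  · exact Continuous.rpow_const (by fun_prop) fun _ => Or.inr hρ.1.le

/-- For each fixed `ρ` the right-hand condition is open in `q`. It serves both the semicontinuity of
the ratio and the error exponent. -/
theorem ofReal_lt_boundRatio_iff {𝒳 𝒴 : Type*} [Fintype 𝒳] [DecidableEq 𝒳] [Fintype 𝒴] {c : ℝ≥0}
    (Ψ : Pattern c → 𝒳) (W : 𝒳 → PMF 𝒴) {q : Pattern c × Pattern c → ℝ}
    (hq : q ∈ stdSimplex ℝ (Pattern c × Pattern c)) {r : ℝ} (hr : 0 ≤ r) :
    ENNReal.ofReal r < boundRatio Ψ W q ↔ ∃ ρ ∈ Set.Ioo (0 : ℝ) 1,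
      ρ * (r * entropyBits (bitFreq (sndType q)) * Real.log 2) <
        1 - chernoffSum ρ (distP Ψ W (fstType q)) (distQ Ψ W q) := by
  have hH : 0 ≤ entropyBits (bitFreq (sndType q)) :=
    entropyBits_nonneg (bitFreq_nonneg (sndType_nonneg hq.1))
      (by rw [sum_bitFreq, sum_sndType, hq.2])
  rw [boundRatio, ofReal_mul_lt_iff_lt_div ENNReal.ofReal_ne_top, ← ENNReal.ofReal_mul hr,
    ofReal_lt_klBits_iff (distP_nonneg Ψ W hq.1) (distQ_nonneg Ψ W hq.1)
      (by rw [sum_distP, hq.2]) (mul_nonneg hr hH)]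

theorem lowerSemicontinuousOn_boundRatio {𝒳 𝒴 : Type*} [Fintype 𝒳] [DecidableEq 𝒳] [Fintype 𝒴]
    {c : ℝ≥0} (Ψ : Pattern c → 𝒳) (W : 𝒳 → PMF 𝒴) :
    LowerSemicontinuousOn (boundRatio Ψ W) (jointTypes c) := by
  intro q₀ hq₀ a ha
  lift a to ℝ≥0 using ha.ne_top
  rw [← ENNReal.ofReal_coe_nnreal] at ha ⊢
  obtain ⟨ρ, hρ, h⟩ := (ofReal_lt_boundRatio_iff Ψ W (jointTypes_subset_stdSimplex hq₀) a.2).1 ha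
  have hopen : IsOpen {q : Pattern c × Pattern c → ℝ |
      ρ * (a * entropyBits (bitFreq (sndType q)) * Real.log 2) <
        1 - chernoffSum ρ (distP Ψ W (fstType q)) (distQ Ψ W q)} := by
    have h1 := continuous_entropyBits_sndType (c := c)
    have h2 := continuous_chernoffSum Ψ W hρ
    exact isOpen_lt (by fun_prop) (by fun_prop)
  filter_upwards [self_mem_nhdsWithin, mem_nhdsWithin_of_mem_nhds (hopen.mem_nhds h)] with q hq hq'
  exact (ofReal_lt_boundRatio_iff Ψ W (jointTypes_subset_stdSimplex hq) a.2).2 ⟨ρ, hρ, hq'⟩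

/-! ### Joint types of fields and attainment of the minimum -/

theorem wrap_zero {k : ℕ} (x : Fin k) : wrap x 0 = x := by
  ext
  simp only [wrap, add_zero]
  rw [Int.emod_eq_of_lt (by positivity) (by exact_mod_cast x.2)]
  simp

theorem patternAt_center {c : ℝ≥0} {k : ℕ} (f : Field k) (h : Fin k × Fin k) :
    patternAt c f h (center c) = f h := by
  simp [patternAt, center, wrap_zero]

theorem bitFreq_fstType_jointType (c : ℝ≥0) {k : ℕ} (f f' : Field k) (u : Fin 2) :
    bitFreq (fstType (jointType c f f')) u =
      ((Finset.univ.filter fun h => f h = u).card : ℝ) / (k : ℝ) ^ 2 := by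
  rw [bitFreq_fstType, sum_jointType_mul]
  simp [patternAt_center]

theorem bitFreq_sndType_jointType (c : ℝ≥0) {k : ℕ} (f f' : Field k) (u : Fin 2) :
    bitFreq (sndType (jointType c f f')) u =
      ((Finset.univ.filter fun h => f' h = u).card : ℝ) / (k : ℝ) ^ 2 := by
  rw [bitFreq_sndType, sum_jointType_mul]
  simp [patternAt_center]

theorem jointBitFreq_jointType (c : ℝ≥0) {k : ℕ} (f f' : Field k) :
    jointBitFreq (jointType c f f') 0 1 + jointBitFreq (jointType c f f') 1 0 =
      (hammingDist f f' : ℝ) / (k : ℝ) ^ 2 := by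
  rw [jointBitFreq_eq, jointBitFreq_eq, sum_jointType_mul, sum_jointType_mul, ← add_div,
    ← Finset.sum_add_distrib, hammingDist, Finset.card_filter]
  push_cast
  congr 1
  refine Finset.sum_congr rfl fun h _ => ?_
  simp only [patternAt_center]
  generalize f h = a
  generalize f' h = b
  fin_cases a <;> fin_cases b <;> simp

theorem feasibleTypes_nonempty (c : ℝ≥0) {D : ℝ} (hD : D ≤ 1) : (feasibleTypes c D).Nonempty := by
  -- A striped `2 × 2` field and its complement: balanced, and at distortion 1.
  refine ⟨jointType c (k := 2) (fun h => h.1) (fun h => 1 - h.1),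
    jointType_mem_jointTypes one_le_two _ _, ?_, ?_, ?_⟩
  · rw [jointBitFreq_jointType]
    have : hammingDist (fun h : Fin 2 × Fin 2 => h.1) (fun h => 1 - h.1) = 4 := by decide
    rw [this]
    norm_num
    exact hD
  · rw [bitFreq_fstType_jointType]
    have : (Finset.univ.filter fun h : Fin 2 × Fin 2 => h.1 = 0).card = 2 := by decide
    rw [this]
    norm_num
  · rw [bitFreq_fstType_jointType]
    have : (Finset.univ.filter fun h : Fin 2 × Fin 2 => h.1 = 1).card = 2 := by decide
    rw [this]
    norm_num

theorem isCompact_feasibleTypes (c : ℝ≥0) (D : ℝ) : IsCompact (feasibleTypes c D) :=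
  isCompact_jointTypes.inter_right
    ((isClosed_le continuous_const
      ((continuous_jointBitFreq 0 1).add (continuous_jointBitFreq 1 0))).inter
    ((isClosed_eq (continuous_bitFreq_fstType 0) continuous_const).inter
      (isClosed_eq (continuous_bitFreq_fstType 1) continuous_const)))

theorem exists_isLeast_boundRatio {𝒳 𝒴 : Type*} [Fintype 𝒳] [DecidableEq 𝒳] [Fintype 𝒴]
    {c : ℝ≥0} (Ψ : Pattern c → 𝒳) (W : 𝒳 → PMF 𝒴) {D : ℝ} (hD : D ≤ 1) :
    ∃ m, IsLeast (boundRatio Ψ W '' feasibleTypes c D) m := by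
  obtain ⟨q, hq, hmin⟩ := LowerSemicontinuousOn.exists_isMinOn (feasibleTypes_nonempty c hD)
    (isCompact_feasibleTypes c D)
    ((lowerSemicontinuousOn_boundRatio Ψ W).mono fun q hq => hq.1)
  refine ⟨_, ⟨q, hq, rfl⟩, ?_⟩
  rintro _ ⟨q', hq', rfl⟩
  exact hmin hq'

/-! ### The random coding bound -/

/-- Writing `t = t ^ (1 - ρ) * t ^ ρ` lets two upper bounds on one probability be interpolated
geometrically. -/
theorem le_rpow_mul_rpow {a b t ρ : ℝ} (ht : 0 ≤ t) (ha : t ≤ a) (hb : t ≤ b)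
    (hρ : ρ ∈ Set.Ioo (0 : ℝ) 1) : t ≤ a ^ (1 - ρ) * b ^ ρ := by
  calc t = t ^ (1 - ρ) * t ^ ρ := by
        rw [← Real.rpow_add_of_nonneg ht (by linarith [hρ.2]) hρ.1.le]; simp
    _ ≤ a ^ (1 - ρ) * b ^ ρ := by
        gcongr
        · exact Real.rpow_nonneg (ht.trans ha) _
        · linarith [hρ.2]
        · exact hρ.1.le

/-- Summing a product over the tuples with prescribed image under `x`. -/
theorem sum_prod_fiber {S A : Type*} [Fintype S] [DecidableEq A] {n : ℕ} (x : S → A)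
    (a : Fin n → A) (φ : Fin n → S → ℝ) :
    ∑ s : Fin n → S with (fun l => x (s l)) = a, ∏ l, φ l (s l) =
      ∏ l, ∑ h with x h = a l, φ l h := by
  classical
  rw [Finset.prod_univ_sum]
  refine Finset.sum_congr ?_ fun _ _ => rfl
  ext s
  simp [Fintype.mem_piFinset, funext_iff]

/-- Random coding bound: the probability that one of the alternatives `j ∈ J` is at least as likely
as the truth, when the sensors have independent uniform positions in `S`. The truth emits `y` at
position `h` with probability `w (x h) y`. -/
theorem sum_likelihood_exceeded_le {S A B ι : Type*} [Fintype S] [Fintype A] [DecidableEq A]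
    [Fintype B] {n : ℕ} (x : S → A) (w : A → B → ℝ) (hw : ∀ a y, 0 ≤ w a y) (J : Finset ι)
    (v : ι → S → B → ℝ) (hv : ∀ j h y, 0 ≤ v j h y) (P Q : A × B → ℝ)
    (hP : ∀ z, ∑ h with x h = z.1, w z.1 z.2 = P z)
    (hQ : ∀ j ∈ J, ∀ z, ∑ h with x h = z.1, v j h z.2 = Q z)
    (hP0 : ∀ z, 0 ≤ P z) (hQ0 : ∀ z, 0 ≤ Q z) {ρ : ℝ} (hρ : ρ ∈ Set.Ioo (0 : ℝ) 1)
    (E : (Fin n → S) → (Fin n → B) → Prop) [∀ s y, Decidable (E s y)]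
    (hE : ∀ s y, E s y → ∃ j ∈ J, ∏ l, w (x (s l)) (y l) ≤ ∏ l, v j (s l) (y l)) :
    ∑ s : Fin n → S, ∑ y : Fin n → B, (if E s y then ∏ l, w (x (s l)) (y l) else 0) ≤
      (J.card : ℝ) ^ ρ * chernoffSum ρ P Q ^ n := by
  classical
  -- With ideal outputs and noisy outputs fixed in `z`, only the positions producing those ideal
  -- outputs vary, so the sum factors over the sensors.
  have key : ∀ z : Fin n → A × B,
      ∑ s : Fin n → S with (fun l => x (s l)) = fun l => (z l).1,
        (if E s (fun l => (z l).2) then ∏ l, w (z l).1 (z l).2 else 0) ≤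
      (J.card : ℝ) ^ ρ * ∏ l, (P (z l) ^ (1 - ρ) * Q (z l) ^ ρ) := by
    intro z
    have h1 : ∑ s : Fin n → S with (fun l => x (s l)) = fun l => (z l).1,
        (if E s (fun l => (z l).2) then ∏ l, w (z l).1 (z l).2 else 0) ≤ ∏ l, P (z l) := by
      calc _ ≤ ∑ s : Fin n → S with (fun l => x (s l)) = fun l => (z l).1,
            ∏ l, w (z l).1 (z l).2 := by
            refine Finset.sum_le_sum fun s _ => ?_
            split_ifs
            · exact le_rfl
            · exact Finset.prod_nonneg fun l _ => hw _ _
        _ = ∏ l, P (z l) := by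
            rw [sum_prod_fiber x (fun l => (z l).1) fun l _ => w (z l).1 (z l).2]
            exact Finset.prod_congr rfl fun l _ => hP _
    -- Union bound: on the error event the likelihood of the truth is at most that of some rival,
    -- hence at most the sum over all of `J`.
    have h2 : ∑ s : Fin n → S with (fun l => x (s l)) = fun l => (z l).1,
        (if E s (fun l => (z l).2) then ∏ l, w (z l).1 (z l).2 else 0) ≤
          J.card * ∏ l, Q (z l) := by
      calc _ ≤ ∑ s : Fin n → S with (fun l => x (s l)) = fun l => (z l).1,
            ∑ j ∈ J, ∏ l, v j (s l) (z l).2 := by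
            refine Finset.sum_le_sum fun s hs => ?_
            have hpos : ∀ j ∈ J, 0 ≤ ∏ l, v j (s l) (z l).2 :=
              fun j _ => Finset.prod_nonneg fun l _ => hv _ _ _
            split_ifs with h
            · obtain ⟨j, hj, hle⟩ := hE _ _ h
              have hs' := (Finset.mem_filter.1 hs).2
              simp only [funext_iff] at hs'
              simp only [hs'] at hle
              exact hle.trans (Finset.single_le_sum hpos hj)
            · exact Finset.sum_nonneg hpos
        _ = ∑ j ∈ J, ∏ l, Q (z l) := by
            rw [Finset.sum_comm]
            refine Finset.sum_congr rfl fun j hj => ?_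
            rw [sum_prod_fiber x (fun l => (z l).1) fun l h => v j h (z l).2]
            exact Finset.prod_congr rfl fun l _ => hQ j hj _
        _ = J.card * ∏ l, Q (z l) := by rw [Finset.sum_const, nsmul_eq_mul]
    refine (le_rpow_mul_rpow ?_ h1 h2 hρ).trans_eq ?_
    · refine Finset.sum_nonneg fun s _ => ?_
      split_ifs
      · exact Finset.prod_nonneg fun l _ => hw _ _
      · exact le_rfl
    · rw [Real.mul_rpow (Nat.cast_nonneg _) (Finset.prod_nonneg fun l _ => hQ0 _),
        ← Real.finsetProd_rpow _ _ fun l _ => hP0 _, ← Real.finsetProd_rpow _ _ fun l _ => hQ0 _,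
        Finset.prod_mul_distrib]
      ring
  calc ∑ s : Fin n → S, ∑ y : Fin n → B, (if E s y then ∏ l, w (x (s l)) (y l) else 0)
      = ∑ z : Fin n → A × B, ∑ s : Fin n → S with (fun l => x (s l)) = fun l => (z l).1,
        (if E s (fun l => (z l).2) then ∏ l, w (z l).1 (z l).2 else 0) := by
        rw [Finset.sum_comm]
        rw [← Equiv.sum_comp (Equiv.arrowProdEquivProdArrow (Fin n) (fun _ => A)
          fun _ => B).symm, Fintype.sum_prod_type_right]
        refine Finset.sum_congr rfl fun y _ => ?_
        rw [← Finset.sum_fiberwise Finset.univ fun (s : Fin n → S) l => x (s l)]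
        refine Finset.sum_congr rfl fun a _ => Finset.sum_congr rfl fun s hs => ?_
        have hs' := (Finset.mem_filter.1 hs).2
        simp only [funext_iff] at hs'
        simp only [Equiv.arrowProdEquivProdArrow, Equiv.coe_fn_symm_mk, hs']
        rfl
    _ ≤ ∑ z : Fin n → A × B, (J.card : ℝ) ^ ρ * ∏ l, (P (z l) ^ (1 - ρ) * Q (z l) ^ ρ) :=
        Finset.sum_le_sum fun z _ => key z
    _ = (J.card : ℝ) ^ ρ * chernoffSum ρ P Q ^ n := by
        rw [← Finset.mul_sum, chernoffSum, Fintype.sum_pow]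

/-! ### Counting fields -/

/-- The number of words with letter frequencies `p` is at most `2 ^ (N H(p))`. -/
theorem card_le_exp_entropyBits {ι α : Type*} [Fintype ι] [DecidableEq ι] [Fintype α]
    [DecidableEq α] {p : α → ℝ} (hp : ∀ u, 0 ≤ p u) (hsum : ∑ u, p u = 1) (J : Finset (ι → α))
    (hJ : ∀ f ∈ J, ∀ u, ((Finset.univ.filter fun h => f h = u).card : ℝ) = Fintype.card ι * p u) :
    (J.card : ℝ) ≤ Real.exp (Fintype.card ι * (entropyBits p * Real.log 2)) := by
  have hl : Real.log 2 ≠ 0 := (Real.log_pos one_lt_two).ne'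
  -- Under the product law of `p` every word of `J` has the same probability, determined by its
  -- letter counts; these probabilities sum to at most 1.
  have h1 : ∀ f ∈ J, ∏ h, p (f h) =
      Real.exp (-(Fintype.card ι * (entropyBits p * Real.log 2))) := by
    intro f hf
    have : entropyBits p * Real.log 2 = -∑ u, p u * Real.log (p u) := by
      rw [entropyBits, Finset.sum_mul, ← Finset.sum_neg_distrib]
      refine Finset.sum_congr rfl fun u _ => ?_
      rw [Real.logb]
      field_simp
    rw [this, mul_neg, neg_neg, Finset.mul_sum, Real.exp_sum,
      ← Finset.prod_fiberwise Finset.univ f]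
    refine Finset.prod_congr rfl fun u _ => ?_
    rw [Finset.prod_congr rfl (g := fun _ => p u) fun h hh => by rw [(Finset.mem_filter.1 hh).2],
      Finset.prod_const, ← mul_assoc, ← hJ f hf u]
    rcases (hp u).eq_or_lt with h0 | h0
    -- A letter of frequency 0 never occurs, so its factor is an empty product.
    · have hc := hJ f hf u
      rw [← h0, mul_zero, Nat.cast_eq_zero] at hc
      rw [hc]; simp
    · rw [Real.exp_nat_mul, Real.exp_log h0]
  have h2 : ∑ f : ι → α, ∏ h, p (f h) = 1 := by
    have := (Finset.prod_univ_sum (fun _ : ι => (Finset.univ : Finset α)) fun _ u => p u).symm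
    rw [Fintype.piFinset_univ] at this
    rw [this]; simp [hsum]
  have h3 : ∑ f ∈ J, ∏ h, p (f h) ≤ 1 := h2 ▸ Finset.sum_le_sum_of_subset_of_nonneg
    (Finset.subset_univ _) fun f _ _ => Finset.prod_nonneg fun h _ => hp _
  rw [Finset.sum_congr rfl h1, Finset.sum_const, nsmul_eq_mul, Real.exp_neg,
    ← div_eq_mul_inv, div_le_one (Real.exp_pos _)] at h3
  exact h3

/-- Most binary words are nearly balanced. -/
theorem card_unbalanced_le {ι : Type*} [Fintype ι] [DecidableEq ι] [Nonempty ι] {δ : ℝ}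
    (hδ : 0 < δ) :
    ((Finset.univ.filter fun f : ι → Fin 2 =>
      δ < |((Finset.univ.filter fun h => f h = 0).card : ℝ) / Fintype.card ι - 1 / 2|).card : ℝ) ≤
      2 * Real.exp (-(Fintype.card ι * (2 * δ ^ 2))) * Fintype.card (ι → Fin 2) := by
  set N : ℝ := ((Fintype.card ι : ℕ) : ℝ) with hN
  have hN0 : 0 < N := by rw [hN]; exact_mod_cast Fintype.card_pos
  set σ : Fin 2 → ℝ := fun u => if u = 0 then 1 else -1 with hσ
  have hmgf : ∀ t : ℝ, ∑ f : ι → Fin 2, Real.exp (∑ h, t * σ (f h)) ≤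
      Real.exp (N * (t ^ 2 / 2)) * Fintype.card (ι → Fin 2) := by
    intro t
    have := (Finset.prod_univ_sum (fun _ : ι => (Finset.univ : Finset (Fin 2)))
      fun _ u => Real.exp (t * σ u)).symm
    rw [Fintype.piFinset_univ] at this
    simp only [Real.exp_sum]
    rw [this, Finset.prod_const, Finset.card_univ, Fintype.card_fun, Fintype.card_fin, hN,
      Real.exp_nat_mul]
    push_cast
    rw [← mul_pow]
    refine pow_le_pow_left₀ (Finset.sum_nonneg fun _ _ => (Real.exp_pos _).le) ?_ _
    have hc := Real.cosh_le_exp_half_sq t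
    rw [Real.cosh_eq] at hc
    simp [hσ]
    linarith
  have hcount : ∀ f : ι → Fin 2, ∀ t : ℝ, ∑ h, t * σ (f h) =
      2 * N * t * (((Finset.univ.filter fun h => f h = 0).card : ℝ) / N - 1 / 2) := by
    intro f t
    have h1 : ∀ h, t * σ (f h) = 2 * t * (if f h = 0 then 1 else 0) - t := by
      intro h; simp only [hσ]; split_ifs <;> ring
    simp only [h1]
    rw [Finset.sum_sub_distrib, ← Finset.mul_sum, Finset.sum_boole, Finset.sum_const,
      Finset.card_univ, nsmul_eq_mul, ← hN]
    field_simp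
  -- Exponential Markov bound for both tails. The choice `t = ± 2δ` minimises `t ^ 2 / 2 - 2 δ |t|`,
  -- which gives the exponent `-2 δ ^ 2`.
  have hpt : ∀ f : ι → Fin 2,
      (if δ < |((Finset.univ.filter fun h => f h = 0).card : ℝ) / N - 1 / 2| then (1 : ℝ) else 0) ≤
      Real.exp (-(N * (4 * δ ^ 2))) * (Real.exp (∑ h, 2 * δ * σ (f h)) +
        Real.exp (∑ h, -(2 * δ) * σ (f h))) := by
    intro f
    rw [hcount, hcount]
    set b := ((Finset.univ.filter fun h => f h = 0).card : ℝ) / N - 1 / 2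
    split_ifs with hb
    · rw [mul_add, ← Real.exp_add, ← Real.exp_add]
      rcases lt_abs.1 hb with hb | hb
      · have : 1 ≤ Real.exp (-(N * (4 * δ ^ 2)) + 2 * N * (2 * δ) * b) := by
          apply Real.one_le_exp
          have : 0 ≤ N * δ * (b - δ) := by
            have := sub_pos.2 hb
            positivity
          nlinarith
        exact this.trans (le_add_of_nonneg_right (Real.exp_pos _).le)
      · have : 1 ≤ Real.exp (-(N * (4 * δ ^ 2)) + 2 * N * -(2 * δ) * b) := by
          apply Real.one_le_exp
          have : 0 ≤ N * δ * (-b - δ) := by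
            have := sub_pos.2 hb
            positivity
          nlinarith
        exact this.trans (le_add_of_nonneg_left (Real.exp_pos _).le)
    · positivity
  rw [Finset.card_filter]
  push_cast
  refine (Finset.sum_le_sum fun f _ => hpt f).trans ?_
  rw [← Finset.mul_sum, Finset.sum_add_distrib]
  calc _ ≤ Real.exp (-(N * (4 * δ ^ 2))) * (Real.exp (N * ((2 * δ) ^ 2 / 2)) *
        Fintype.card (ι → Fin 2) + Real.exp (N * ((-(2 * δ)) ^ 2 / 2)) *
        Fintype.card (ι → Fin 2)) := by
        gcongr
        · exact hmgf _
        · exact hmgf _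
    _ = 2 * (Real.exp (-(N * (4 * δ ^ 2))) * Real.exp (N * (2 * δ ^ 2))) *
        Fintype.card (ι → Fin 2) := by ring_nf
    _ = _ := by rw [← Real.exp_add]; ring_nf

/-! ### Maximum likelihood error summed over networks -/

theorem chernoffSum_nonneg {ι : Type*} [Fintype ι] {ρ : ℝ} {p q : ι → ℝ} (hp : ∀ z, 0 ≤ p z)
    (hq : ∀ z, 0 ≤ q z) : 0 ≤ chernoffSum ρ p q :=
  Finset.sum_nonneg fun z _ => mul_nonneg (Real.rpow_nonneg (hp z) _) (Real.rpow_nonneg (hq z) _)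

/-- The exponents add up to 1. With `a = k ^ 2` this passes from counts of positions to frequencies;
its `n`-th power contributes the number of networks. -/
theorem chernoffSum_mul {ι : Type*} [Fintype ι] {ρ a : ℝ} {p q : ι → ℝ} (hp : ∀ z, 0 ≤ p z)
    (hq : ∀ z, 0 ≤ q z) (ha : 0 ≤ a) :
    chernoffSum ρ (fun z => a * p z) (fun z => a * q z) = a * chernoffSum ρ p q := by
  rw [chernoffSum, chernoffSum, Finset.mul_sum]
  refine Finset.sum_congr rfl fun z _ => ?_
  rw [Real.mul_rpow ha (hp z), Real.mul_rpow ha (hq z)]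
  have : a ^ (1 - ρ) * a ^ ρ = a := by
    rw [← Real.rpow_add' ha (by simp)]; simp
  calc _ = (a ^ (1 - ρ) * a ^ ρ) * (p z ^ (1 - ρ) * q z ^ ρ) := by ring
    _ = _ := by rw [this]

theorem outputProb_nonneg {𝒳 𝒴 : Type*} {c : ℝ≥0} (Ψ : Pattern c → 𝒳)
    (W : 𝒳 → PMF 𝒴) {k n : ℕ} (s : Network k n) (f : Field k) (y : Fin n → 𝒴) :
    0 ≤ outputProb Ψ W s f y := Finset.prod_nonneg fun _ _ => ENNReal.toReal_nonneg

theorem sum_outputProb {𝒳 𝒴 : Type*} [Fintype 𝒴] {c : ℝ≥0} (Ψ : Pattern c → 𝒳)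
    (W : 𝒳 → PMF 𝒴) {k n : ℕ} (s : Network k n) (f : Field k) :
    ∑ y, outputProb Ψ W s f y = 1 := by
  classical
  have := (Finset.prod_univ_sum (fun _ : Fin n => (Finset.univ : Finset 𝒴))
    fun l y => (W (Ψ (patternAt c f (s l))) y).toReal).symm
  rw [Fintype.piFinset_univ] at this
  unfold outputProb
  rw [this]
  simp [pmf_sum_toReal]

theorem errorGiven_nonneg {𝒳 𝒴 : Type*} [Fintype 𝒴] {c : ℝ≥0} (Ψ : Pattern c → 𝒳)
    (W : 𝒳 → PMF 𝒴) (D : ℝ) {k n : ℕ} (s : Network k n) (g : (Fin n → 𝒴) → Field k)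
    (f : Field k) : 0 ≤ errorGiven Ψ W D s g f := by
  refine Finset.sum_nonneg fun y _ => ?_
  split_ifs
  · exact le_rfl
  · exact outputProb_nonneg Ψ W s f y

theorem errorGiven_le_one {𝒳 𝒴 : Type*} [Fintype 𝒴] {c : ℝ≥0} (Ψ : Pattern c → 𝒳)
    (W : 𝒳 → PMF 𝒴) (D : ℝ) {k n : ℕ} (s : Network k n) (g : (Fin n → 𝒴) → Field k)
    (f : Field k) : errorGiven Ψ W D s g f ≤ 1 := by
  rw [← sum_outputProb Ψ W s f]
  refine Finset.sum_le_sum fun y _ => ?_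
  split_ifs
  · exact outputProb_nonneg Ψ W s f y
  · exact le_rfl

theorem sq_mul_sum_jointType {c : ℝ≥0} {k : ℕ} (hk : 1 ≤ k) (f f' : Field k)
    (φ : Pattern c × Pattern c → ℝ) :
    (k : ℝ) ^ 2 * ∑ p, jointType c f f' p * φ p =
      ∑ h, φ (patternAt c f h, patternAt c f' h) := by
  rw [sum_jointType_mul]
  have : (k : ℝ) ≠ 0 := by positivity
  field_simp

open scoped Classical in
/-- Total probability over all networks that the maximum likelihood detector chooses one of the
fields `f' ∈ J`, which all have the same joint type with `f`. -/
theorem sum_likelihood_exceeded_type_le {𝒳 𝒴 : Type*} [Fintype 𝒳] [DecidableEq 𝒳] [Fintype 𝒴]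
    {c : ℝ≥0} (Ψ : Pattern c → 𝒳) (W : 𝒳 → PMF 𝒴) {k n : ℕ} (hk : 1 ≤ k) (f : Field k)
    (g : Network k n → (Fin n → 𝒴) → Field k)
    (hg : ∀ s y f', outputProb Ψ W s f' y ≤ outputProb Ψ W s (g s y) y)
    (J : Finset (Field k)) (q : Pattern c × Pattern c → ℝ)
    (hJ : ∀ f' ∈ J, jointType c f f' = q) (hne : J.Nonempty) {ρ : ℝ}
    (hρ : ρ ∈ Set.Ioo (0 : ℝ) 1) :
    ∑ s : Network k n, ∑ y, (if g s y ∈ J then outputProb Ψ W s f y else 0) ≤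
      (((k : ℝ) ^ 2) ^ n) *
        (Real.exp (ρ * ((k : ℝ) ^ 2 * (entropyBits (bitFreq (sndType q)) * Real.log 2))) *
          chernoffSum ρ (distP Ψ W (fstType q)) (distQ Ψ W q) ^ n) := by
  obtain ⟨f₀, hf₀⟩ := hne
  have hq0 : ∀ p, 0 ≤ q p := hJ f₀ hf₀ ▸ jointType_nonneg f f₀
  have hq1 : ∑ p, q p = 1 := hJ f₀ hf₀ ▸ sum_jointType hk f f₀
  have hk0 : (k : ℝ) ≠ 0 := by positivity
  have hcard : (J.card : ℝ) ≤
      Real.exp ((k : ℝ) ^ 2 * (entropyBits (bitFreq (sndType q)) * Real.log 2)) := by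
    have := card_le_exp_entropyBits (p := bitFreq (sndType q))
      (bitFreq_nonneg (sndType_nonneg hq0)) (by rw [sum_bitFreq, sum_sndType, hq1]) J
      fun f' hf' u => by
        rw [← hJ f' hf', bitFreq_sndType_jointType]
        simp
        field_simp
    simpa [sq] using this
  have hmain := sum_likelihood_exceeded_le (n := n) (fun h => Ψ (patternAt c f h))
    (fun a y => (W a y).toReal) (fun _ _ => ENNReal.toReal_nonneg) J
    (fun f' h y => (W (Ψ (patternAt c f' h)) y).toReal) (fun _ _ _ => ENNReal.toReal_nonneg)
    (fun z => (k : ℝ) ^ 2 * distP Ψ W (fstType q) z) (fun z => (k : ℝ) ^ 2 * distQ Ψ W q z)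
    (fun z => by
      rw [distP_fstType, ← hJ f₀ hf₀, sq_mul_sum_jointType hk, Finset.sum_filter])
    (fun f' hf' z => by
      rw [distQ_eq, ← hJ f' hf', sq_mul_sum_jointType hk, Finset.sum_filter])
    (fun z => mul_nonneg (by positivity) (distP_nonneg Ψ W hq0 z))
    (fun z => mul_nonneg (by positivity) (distQ_nonneg Ψ W hq0 z)) hρ
    (fun s y => g s y ∈ J) (fun s y h => ⟨g s y, h, hg s y f⟩)
  refine hmain.trans ?_
  rw [chernoffSum_mul (distP_nonneg Ψ W hq0) (distQ_nonneg Ψ W hq0) (by positivity), mul_pow,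
    mul_left_comm]
  have hF := chernoffSum_nonneg (ρ := ρ) (distP_nonneg Ψ W hq0) (distQ_nonneg Ψ W hq0)
  gcongr
  rw [mul_comm ρ, Real.exp_mul]
  exact Real.rpow_le_rpow (Nat.cast_nonneg _) hcard hρ.1.le

/-- Total error of the maximum likelihood detector over all networks, for a given field. -/
theorem sum_errorGiven_le {𝒳 𝒴 : Type*} [Fintype 𝒳] [DecidableEq 𝒳] [Fintype 𝒴]
    {c : ℝ≥0} (Ψ : Pattern c → 𝒳) (W : 𝒳 → PMF 𝒴) (D : ℝ) {k n : ℕ} (hk : 1 ≤ k) (f : Field k)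
    (g : Network k n → (Fin n → 𝒴) → Field k)
    (hg : ∀ s y f', outputProb Ψ W s f' y ≤ outputProb Ψ W s (g s y) y) {B : ℝ} (hB : 0 ≤ B)
    (hf : ∀ f', ¬ Tolerable D f f' → ∃ ρ ∈ Set.Ioo (0 : ℝ) 1,
      Real.exp (ρ * ((k : ℝ) ^ 2 *
        (entropyBits (bitFreq (sndType (jointType c f f'))) * Real.log 2))) *
          chernoffSum ρ (distP Ψ W (fstType (jointType c f f')))
            (distQ Ψ W (jointType c f f')) ^ n ≤ B) :
    ∑ s, errorGiven Ψ W D s (g s) f ≤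
      ((k : ℝ) ^ 2 + 1) ^ Fintype.card (Pattern c × Pattern c) * (((k : ℝ) ^ 2) ^ n * B) := by
  classical
  -- `T` records the joint type with `f` as integer counts in `0, …, k ^ 2`, so the number of
  -- classes is polynomial in `k`.
  set T : Field k → (Pattern c × Pattern c → Fin (k ^ 2 + 1)) := fun f' p =>
    ⟨(Finset.univ.filter fun h : Fin k × Fin k =>
      patternAt c f h = p.1 ∧ patternAt c f' h = p.2).card, Nat.lt_succ_of_le
        ((Finset.card_le_univ _).trans_eq (by simp [sq]))⟩ with hT
  have hTq : ∀ f₁ f₂, T f₁ = T f₂ → jointType c f f₁ = jointType c f f₂ := by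
    intro f₁ f₂ h
    ext p
    have := congrArg Fin.val (congrFun h p)
    simp only [hT] at this
    rw [jointType, jointType, this]
  set J : (Pattern c × Pattern c → Fin (k ^ 2 + 1)) → Finset (Field k) := fun t =>
    Finset.univ.filter fun f' => ¬ Tolerable D f f' ∧ T f' = t with hJdef
  have hstep : ∀ t, ∑ s : Network k n, ∑ y, (if g s y ∈ J t then outputProb Ψ W s f y else 0) ≤
      ((k : ℝ) ^ 2) ^ n * B := by
    intro t
    rcases (J t).eq_empty_or_nonempty with h | h
    · rw [h]
      simp only [Finset.notMem_empty, if_false, Finset.sum_const_zero]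
      positivity
    · obtain ⟨f₀, hf₀⟩ := id h
      have hf₀' := (Finset.mem_filter.1 hf₀).2
      obtain ⟨ρ, hρ, hle⟩ := hf f₀ hf₀'.1
      refine (sum_likelihood_exceeded_type_le Ψ W hk f g hg (J t) (jointType c f f₀)
        (fun f' hf' => hTq _ _ ?_) h hρ).trans ?_
      · rw [(Finset.mem_filter.1 hf').2.2, hf₀'.2]
      · gcongr
  calc ∑ s, errorGiven Ψ W D s (g s) f
      = ∑ t, ∑ s : Network k n, ∑ y, (if g s y ∈ J t then outputProb Ψ W s f y else 0) := by
        rw [Finset.sum_comm]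
        refine Finset.sum_congr rfl fun s _ => ?_
        rw [Finset.sum_comm]
        refine Finset.sum_congr rfl fun y _ => ?_
        rw [Finset.sum_eq_single (T (g s y))]
        · by_cases h : Tolerable D f (g s y) <;> simp [hJdef, h]
        · intro t _ ht
          simp [hJdef, ht.symm]
        · simp
    _ ≤ ∑ t : Pattern c × Pattern c → Fin (k ^ 2 + 1), ((k : ℝ) ^ 2) ^ n * B :=
        Finset.sum_le_sum fun t _ => hstep t
    _ = _ := by
        rw [Finset.sum_const, nsmul_eq_mul, Finset.card_univ, Fintype.card_fun, Fintype.card_fin]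
        push_cast
        rfl

/-- The averaged error is at most the fraction of atypical fields plus a uniform bound on the error
of typical fields. -/
theorem average_expectedError_le {𝒳 𝒴 : Type*} [Fintype 𝒴] {c : ℝ≥0} (Ψ : Pattern c → 𝒳)
    (W : 𝒳 → PMF 𝒴) (D : ℝ) {k n : ℕ} (hk : 1 ≤ k) (g : Network k n → (Fin n → 𝒴) → Field k)
    (U : Finset (Field k)) {a b : ℝ} (hb : 0 ≤ b) (hU : (U.card : ℝ) ≤ a * Fintype.card (Field k))
    (hf : ∀ f ∉ U, ∑ s, errorGiven Ψ W D s (g s) f ≤ Fintype.card (Network k n) * b) :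
    (∑ s, expectedError Ψ W D s (g s)) / Fintype.card (Network k n) ≤ a + b := by
  classical
  have : NeZero k := ⟨by omega⟩
  have hN : (0 : ℝ) < Fintype.card (Network k n) := by exact_mod_cast Fintype.card_pos
  have hF : (0 : ℝ) < Fintype.card (Field k) := by exact_mod_cast Fintype.card_pos
  rw [div_le_iff₀ hN]
  unfold expectedError
  rw [← Finset.sum_div, div_le_iff₀ hF, Finset.sum_comm]
  calc ∑ f, ∑ s, errorGiven Ψ W D s (g s) f
      ≤ ∑ f : Field k, ((if f ∈ U then (Fintype.card (Network k n) : ℝ) else 0) +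
          Fintype.card (Network k n) * b) := by
        refine Finset.sum_le_sum fun f _ => ?_
        split_ifs with h
        · have : ∑ s, errorGiven Ψ W D s (g s) f ≤ ∑ s : Network k n, (1 : ℝ) :=
            Finset.sum_le_sum fun s _ => errorGiven_le_one Ψ W D s (g s) f
          rw [Finset.sum_const, Finset.card_univ, nsmul_eq_mul, mul_one] at this
          have := mul_nonneg hN.le hb
          linarith
        · rw [zero_add]; exact hf f h
    _ = Fintype.card (Network k n) * U.card +
          Fintype.card (Field k) * (Fintype.card (Network k n) * b) := by
        rw [Finset.sum_add_distrib, Finset.sum_ite_mem]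
        simp [mul_comm]
    _ ≤ Fintype.card (Network k n) * (a * Fintype.card (Field k)) +
          Fintype.card (Field k) * (Fintype.card (Network k n) * b) := by gcongr
    _ = _ := by ring

/-! ### Uniform exponents by compactness -/

/-- If `R` is below the ratio on all feasible types, the exponents are bounded away from zero on all
nearly feasible types. -/
theorem exists_uniform_exponent {𝒳 𝒴 : Type*} [Fintype 𝒳] [DecidableEq 𝒳] [Fintype 𝒴]
    {c : ℝ≥0} (Ψ : Pattern c → 𝒳) (W : 𝒳 → PMF 𝒴) {D R : ℝ} (hR : 0 ≤ R)
    (hlt : ∀ q ∈ feasibleTypes c D, ENNReal.ofReal R < boundRatio Ψ W q) :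
    ∃ δ ∈ Set.Ioo (0 : ℝ) 1, ∀ q ∈ jointTypes c,
      D ≤ jointBitFreq q 0 1 + jointBitFreq q 1 0 →
      |bitFreq (fstType q) 0 - 1 / 2| ≤ δ → ∃ ρ ∈ Set.Ioo (0 : ℝ) 1,
        Real.exp (ρ * (R * (entropyBits (bitFreq (sndType q)) * Real.log 2))) *
          chernoffSum ρ (distP Ψ W (fstType q)) (distQ Ψ W q) ≤ 1 - δ := by
  set G : ℝ → (Pattern c × Pattern c → ℝ) → ℝ := fun ρ q =>
    Real.exp (ρ * (R * (entropyBits (bitFreq (sndType q)) * Real.log 2))) *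
      chernoffSum ρ (distP Ψ W (fstType q)) (distQ Ψ W q) with hG
  -- The denominator starts at 2, so every `d i` is strictly below 1.
  set d : ℕ → ℝ := fun i => 1 / ((i : ℝ) + 1 + 1) with hd
  have hd0 : ∀ i, 0 < d i := fun i => by positivity
  have hdanti : Antitone d := fun i j hij => by
    have : (i : ℝ) ≤ j := by exact_mod_cast hij
    simp only [hd]
    gcongr
  have hdlim : ∀ ε : ℝ, 0 < ε → ∃ i, d i < ε := fun ε hε => by
    obtain ⟨i, hi⟩ := exists_nat_one_div_lt hε
    refine ⟨i, lt_of_le_of_lt ?_ hi⟩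
    simp only [hd]
    gcongr
    linarith
  -- An increasing open cover: a type is unbalanced by more than `d i`, or some `ρ` gives margin `d
  -- i`. By monotonicity and compactness one index suffices, and on nearly balanced types only the
  -- second alternative remains.
  set U : ℕ → Set (Pattern c × Pattern c → ℝ) := fun i =>
    {q | d i < |bitFreq (fstType q) 0 - 1 / 2|} ∪
      ⋃ ρ ∈ Set.Ioo (0 : ℝ) 1, {q | G ρ q < 1 - d i} with hU
  have hopen : ∀ i, IsOpen (U i) := by
    intro i
    refine IsOpen.union ?_ (isOpen_biUnion fun ρ hρ => ?_)
    · exact isOpen_lt continuous_const ((continuous_bitFreq_fstType 0).sub continuous_const).abs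
    · have h1 := continuous_entropyBits_sndType (c := c)
      have h2 := continuous_chernoffSum Ψ W hρ
      exact isOpen_lt (by fun_prop) continuous_const
  have hmono : Monotone U := by
    intro i j hij
    refine Set.union_subset_union (fun q hq => (hdanti hij).trans_lt hq)
      (Set.iUnion₂_mono fun ρ _ q hq => ?_)
    have := hdanti hij
    simp only [Set.mem_ofPred_eq] at hq ⊢
    linarith
  have hcomp : IsCompact (jointTypes c ∩ {q | D ≤ jointBitFreq q 0 1 + jointBitFreq q 1 0}) :=
    isCompact_jointTypes.inter_right (isClosed_le continuous_const
      ((continuous_jointBitFreq 0 1).add (continuous_jointBitFreq 1 0)))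
  obtain ⟨i, hi⟩ := hcomp.elim_directed_cover U hopen (by
    rintro q ⟨hq, hqD⟩
    have hs := jointTypes_subset_stdSimplex hq
    rw [Set.mem_iUnion]
    by_cases hb : bitFreq (fstType q) 0 = 1 / 2
    · have hsum := sum_bitFreq (fstType q)
      rw [sum_fstType, hs.2, Fin.sum_univ_two] at hsum
      obtain ⟨ρ, hρ, h⟩ := (ofReal_lt_boundRatio_iff Ψ W hs hR).1
        (hlt q ⟨hq, hqD, hb, by linarith⟩)
      have hlt1 : G ρ q < 1 := by
        set u := ρ * (R * (entropyBits (bitFreq (sndType q)) * Real.log 2)) with hu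
        -- The Chernoff sum is below `1 - u`, which is at most `exp (-u)`.
        have h1 : chernoffSum ρ (distP Ψ W (fstType q)) (distQ Ψ W q) < Real.exp (-u) := by
          have := Real.add_one_le_exp (-u)
          rw [mul_assoc R] at h
          linarith
        have := mul_lt_mul_of_pos_left h1 (Real.exp_pos u)
        rwa [← Real.exp_add, add_neg_cancel, Real.exp_zero] at this
      obtain ⟨i, hi⟩ := hdlim (1 - G ρ q) (by linarith)
      refine ⟨i, Or.inr (Set.mem_biUnion hρ ?_)⟩
      simp only [Set.mem_ofPred_eq]
      linarith
    · obtain ⟨i, hi⟩ := hdlim _ (abs_pos.2 (sub_ne_zero.2 hb))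
      exact ⟨i, Or.inl hi⟩) hmono.directed_le
  refine ⟨d i, ⟨hd0 i, ?_⟩, fun q hq hqD hb => ?_⟩
  · simp only [hd]
    rw [div_lt_one (by positivity)]
    have : (0 : ℝ) ≤ i := Nat.cast_nonneg i
    linarith
  · rcases hi ⟨hq, hqD⟩ with h | h
    · exact absurd h (not_lt.2 hb)
    · simp only [Set.mem_iUnion] at h
      obtain ⟨ρ, hρ, h⟩ := h
      exact ⟨ρ, hρ, le_of_lt h⟩

/-! ### The limit of many sensors -/

theorem mul_le_gridSide_sq {R : ℝ} (hR : 0 ≤ R) (n : ℕ) :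
    n * R ≤ (gridSide R n : ℝ) ^ 2 := by
  have h0 : 0 ≤ (n : ℝ) * R := by positivity
  calc (n : ℝ) * R = √(n * R) ^ 2 := (Real.sq_sqrt h0).symm
    _ ≤ _ := by
      gcongr
      exact Nat.le_ceil _

/-- Rounding the side up adds at most `2 √(n R) + 1` to its square, which is eventually less than `n
(R' - R)`. -/
theorem eventually_gridSide_sq_le {R R' : ℝ} (hR : 0 ≤ R) (h : R < R') :
    ∀ᶠ n : ℕ in atTop, (gridSide R n : ℝ) ^ 2 ≤ n * R' := by
  have ht : Tendsto (fun n : ℕ => √(n : ℝ)) atTop atTop :=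
    Real.tendsto_sqrt_atTop.comp tendsto_natCast_atTop_atTop
  filter_upwards [ht.eventually_ge_atTop ((2 * √R + 1) / (R' - R)),
    ht.eventually_ge_atTop 1] with n hn hn1
  have h1 : (gridSide R n : ℝ) ≤ √(n * R) + 1 := (Nat.ceil_lt_add_one (Real.sqrt_nonneg _)).le
  rw [Real.sqrt_mul (Nat.cast_nonneg n)] at h1
  rw [div_le_iff₀ (sub_pos.2 h)] at hn
  have h2 : √(n : ℝ) ^ 2 = n := Real.sq_sqrt (Nat.cast_nonneg n)
  have h3 : √R ^ 2 = R := Real.sq_sqrt hR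
  set a := √(n : ℝ)
  set b := √R
  calc (gridSide R n : ℝ) ^ 2 ≤ (a * b + 1) ^ 2 := by gcongr
    _ = a ^ 2 * b ^ 2 + 2 * b * a + 1 := by ring
    _ ≤ a ^ 2 * R + a * (a * (R' - R)) := by
      rw [h3]
      nlinarith [mul_le_mul_of_nonneg_left hn (zero_le_one.trans hn1)]
    _ = n * R' := by rw [← h2]; ring

/-- The first term accounts for unbalanced fields; in the second, a polynomial number of types meets
an exponentially small error per type. -/
theorem tendsto_ensemble_bound {R R' δ : ℝ} (C : ℕ) (hR : 0 < R) (hR' : 0 ≤ R')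
    (hδ : δ ∈ Set.Ioo (0 : ℝ) 1) :
    Tendsto (fun n : ℕ => 2 * Real.exp (-(n * R * (2 * δ ^ 2))) +
      (n * R' + 1) ^ C * (1 - δ) ^ n) atTop (𝓝 0) := by
  have h1 : Tendsto (fun n : ℕ => 2 * Real.exp (-(n * R * (2 * δ ^ 2)))) atTop (𝓝 0) := by
    rw [← mul_zero (2 : ℝ)]
    refine Tendsto.const_mul _ (Real.tendsto_exp_neg_atTop_nhds_zero.comp ?_)
    simp only [mul_assoc]
    have := hδ.1
    exact tendsto_natCast_atTop_atTop.atTop_mul_const (by positivity)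
  have h2 : Tendsto (fun n : ℕ => (n * R' + 1) ^ C * (1 - δ) ^ n) atTop (𝓝 0) := by
    have ht := (tendsto_pow_const_mul_const_pow_of_abs_lt_one C (r := 1 - δ) (by
      rw [abs_lt]; constructor <;> linarith [hδ.1, hδ.2])).const_mul ((R' + 1) ^ C)
    rw [mul_zero] at ht
    have hd : 0 ≤ 1 - δ := by linarith [hδ.2]
    refine squeeze_zero' (Eventually.of_forall fun n => by positivity) ?_ ht
    filter_upwards [eventually_ge_atTop 1] with n hn
    have hn' : (1 : ℝ) ≤ n := by exact_mod_cast hn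
    rw [← mul_assoc, ← mul_pow]
    gcongr
    linarith
  simpa using h1.add h2

/-- The gap between `R` and `R'` absorbs the rounding of the grid side: eventually `n R ≤ k ^ 2 ≤ n
R'`. The lower bound controls unbalanced fields, the upper bound the number of rivals and of types.
-/
theorem ensembleAchievable_of_lt {𝒳 𝒴 : Type*} [Fintype 𝒳] [DecidableEq 𝒳] [Fintype 𝒴]
    {c : ℝ≥0} (Ψ : Pattern c → 𝒳) (W : 𝒳 → PMF 𝒴) {D R R' : ℝ} (hR : 0 < R) (hRR' : R < R')
    (hlt : ∀ q ∈ feasibleTypes c D, ENNReal.ofReal R' < boundRatio Ψ W q) :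
    EnsembleAchievable Ψ W D R := by
  classical
  have hR' : 0 < R' := hR.trans hRR'
  obtain ⟨δ, hδ, hexp⟩ := exists_uniform_exponent Ψ W hR'.le hlt
  have hd : 0 < 1 - δ := by linarith [hδ.2]
  -- The maximum likelihood detector.
  choose g hg using fun (n : ℕ) (s : Network (gridSide R n) n) (y : Fin n → 𝒴) =>
    Finite.exists_max fun f : Field (gridSide R n) => outputProb Ψ W s f y
  set C := Fintype.card (Pattern c × Pattern c)
  refine ⟨g, squeeze_zero' (Eventually.of_forall fun n => ?_) ?_
    (tendsto_ensemble_bound C hR hR'.le hδ)⟩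
  · refine div_nonneg (Finset.sum_nonneg fun s _ => div_nonneg (Finset.sum_nonneg fun f _ =>
      errorGiven_nonneg Ψ W D s (g n s) f) (Nat.cast_nonneg _)) (Nat.cast_nonneg _)
  filter_upwards [eventually_ge_atTop 1, eventually_gridSide_sq_le hR.le hRR'] with n hn hupper
  have hlower := mul_le_gridSide_sq hR.le n
  have hn0 : (1 : ℝ) ≤ n := by exact_mod_cast hn
  have hk : 1 ≤ gridSide R n := Nat.one_le_ceil_iff.2 (Real.sqrt_pos.2 (by positivity))
  have hgn := hg n
  generalize g n = g at hgn ⊢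
  generalize gridSide R n = k at *
  have : NeZero k := ⟨by omega⟩
  have hcard : (Fintype.card (Fin k × Fin k) : ℝ) = (k : ℝ) ^ 2 := by simp [sq]
  have hcardN : (Fintype.card (Network k n) : ℝ) = ((k : ℝ) ^ 2) ^ n := by simp [sq]
  have hU := card_unbalanced_le (ι := Fin k × Fin k) hδ.1
  rw [hcard] at hU
  refine (average_expectedError_le Ψ W D hk g _
    (b := ((k : ℝ) ^ 2 + 1) ^ C * (1 - δ) ^ n) (by positivity) hU fun f hf => ?_).trans ?_
  · have hbal := not_lt.1 fun h => hf (Finset.mem_filter.2 ⟨Finset.mem_univ _, h⟩)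
    rw [hcardN, mul_left_comm]
    refine sum_errorGiven_le Ψ W D hk f g hgn (by positivity) fun f' hf' => ?_
    have hqS := jointTypes_subset_stdSimplex (jointType_mem_jointTypes (c := c) hk f f')
    obtain ⟨ρ, hρ, hle⟩ := hexp (jointType c f f') (jointType_mem_jointTypes hk f f')
      (by rw [jointBitFreq_jointType]; exact not_lt.1 hf')
      (by rw [bitFreq_fstType_jointType]; exact hbal)
    refine ⟨ρ, hρ, ?_⟩
    have hH : 0 ≤ entropyBits (bitFreq (sndType (jointType c f f'))) :=
      entropyBits_nonneg (bitFreq_nonneg (sndType_nonneg hqS.1))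
        (by rw [sum_bitFreq, sum_sndType, hqS.2])
    have hF := chernoffSum_nonneg (ρ := ρ) (distP_nonneg Ψ W hqS.1) (distQ_nonneg Ψ W hqS.1)
    have hl : 0 < Real.log 2 := Real.log_pos one_lt_two
    have hρ0 := hρ.1.le
    refine le_trans ?_ (pow_le_pow_left₀ (mul_nonneg (Real.exp_pos _).le hF) hle n)
    rw [mul_pow, ← Real.exp_nat_mul]
    refine mul_le_mul_of_nonneg_right (Real.exp_le_exp.2 ?_) (pow_nonneg hF n)
    calc _ ≤ ρ * (n * R' * (entropyBits (bitFreq (sndType (jointType c f f'))) *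
          Real.log 2)) := by gcongr
      _ = _ := by ring
  · gcongr

/-- For each `n`, some network does at least as well as the average. -/
theorem EnsembleAchievable.achievable {𝒳 𝒴 : Type*} [Fintype 𝒴] {c : ℝ≥0} {Ψ : Pattern c → 𝒳}
    {W : 𝒳 → PMF 𝒴} {D R : ℝ} (hR : 0 < R) (h : EnsembleAchievable Ψ W D R) :
    Achievable Ψ W D R := by
  obtain ⟨g, hg⟩ := h
  have hex : ∀ n, ∃ s : Network (gridSide R n) n, expectedError Ψ W D s (g n s) ≤
      (∑ s : Network (gridSide R n) n, expectedError Ψ W D s (g n s)) /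
        (Fintype.card (Network (gridSide R n) n) : ℝ) := by
    intro n
    have : Nonempty (Network (gridSide R n) n) := by
      -- For `n = 0` the grid is empty, but the empty network still exists.
      rcases n with _ | n
      · exact ⟨Fin.elim0⟩
      · have hk : 0 < gridSide R (n + 1) := Nat.ceil_pos.2 (Real.sqrt_pos.2 (by positivity))
        exact ⟨fun _ => (⟨0, hk⟩, ⟨0, hk⟩)⟩
    obtain ⟨s, -, hs⟩ := Finset.exists_le_of_sum_le (s := Finset.univ) Finset.univ_nonempty
      (f := fun s : Network (gridSide R n) n => expectedError Ψ W D s (g n s))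
      (g := fun _ => (∑ s : Network (gridSide R n) n, expectedError Ψ W D s (g n s)) /
        (Fintype.card (Network (gridSide R n) n) : ℝ)) (by
        rw [Finset.sum_const, Finset.card_univ, nsmul_eq_mul, mul_div_cancel₀]
        exact_mod_cast Fintype.card_ne_zero)
    exact ⟨s, hs⟩
  choose s hs using hex
  refine ⟨s, fun n => g n (s n), squeeze_zero (fun n => ?_) hs hg⟩
  exact div_nonneg (Finset.sum_nonneg fun f _ => errorGiven_nonneg Ψ W D _ _ f) (Nat.cast_nonneg _)

end SensorField

theorem mainTheorem4 {𝒳 𝒴 : Type*} [Fintype 𝒳] [DecidableEq 𝒳] [Fintype 𝒴]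
    (c : ℝ≥0) (Ψ : SensorField.Pattern c → 𝒳) (W : 𝒳 → PMF 𝒴)
    (D : ℝ) (hD0 : 0 ≤ D) (hD1 : D ≤ 1) :
    ∃ m : ℝ≥0∞,
      IsLeast (SensorField.boundRatio Ψ W '' SensorField.feasibleTypes c D) m ∧
      m ≤ SensorField.sensingCapacity Ψ W D ∧
      ∀ R : ℝ, 0 < R → ENNReal.ofReal R < m → SensorField.EnsembleAchievable Ψ W D R := by
  obtain ⟨m, hm⟩ := SensorField.exists_isLeast_boundRatio Ψ W hD1
  have hach : ∀ R : ℝ, 0 < R → ENNReal.ofReal R < m →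
      SensorField.EnsembleAchievable Ψ W D R := by
    intro R hR hlt
    -- The intermediate rate provides the room needed for rounding, while staying below the minimum.
    obtain ⟨R', -, h1, h2⟩ := ENNReal.lt_iff_exists_real_btwn.1 hlt
    exact SensorField.ensembleAchievable_of_lt Ψ W hR (ENNReal.ofReal_lt_ofReal_iff'.1 h1).1
      fun q hq => h2.trans_le (hm.2 ⟨q, hq, rfl⟩)
  exact ⟨m, hm, le_sSup fun R hR hlt => (hach R hR hlt).achievable hR, hach⟩
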